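/- Let $d$ be a non-zero square-free integer (possibly negative), and let $E^d/\mathbb{Q}$ be the elliptic curve $y^2 = x^3 - 4320d^2x + 96768d^3$. Fix an algebraic closure $\overline{\mathbb{Q}}$ of $\mathbb{Q}$, and for $n\ge 1$ let $\mathbb{Q}(E^d[n])\subset\overline{\mathbb{Q}}$ be the field generated over $\mathbb{Q}$ by the affine coordinates of all non-zero points $P\in E^d(\overline{\mathbb{Q}})$ with $nP=0$. Put $f_4(x)=x^8+6x^4+1$ and $$\begin{aligned} f_8(x)={}&x^{32} + 16x^{31} + 128x^{30} + 672x^{29} + 2544x^{28} + 7200x^{27} + 15352x^{26} + 24272x^{25} + 26904x^{24} + 17312x^{23}\\ &- 304x^{22} - 11984x^{21} - 9672x^{20} - 2720x^{19} - 3592x^{18} - 7552x^{17} - 2798x^{16} + 6224x^{15} + 6368x^{14} - 672x^{13}\\ &- 2224x^{12} + 3360x^{11} + 4952x^{10} - 1072x^9 - 4600x^8 - 1120x^7 + 1776x^6 + 752x^5 - 264x^4 - 96x^3 + 24x^2 + 1. \end{aligned}$$ Then, for any root $\alpha$ of $f_4$ and any root $\beta$ of $f_8$ in $\overline{\mathbb{Q}}$,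 and for any choice of the roots $\sqrt{2}$, $\sqrt{d}$, $\sqrt[4]{2}$ in $\overline{\mathbb{Q}}$: \begin{itemize} \item $\mathbb{Q}(E^d[2])=\mathbb{Q}(\sqrt{2})$; \item $\mathbb{Q}(E^d[4])=\mathbb{Q}(\alpha,\sqrt{d}\,\sqrt[4]{2})$; \item $\mathbb{Q}(E^d[8])=\mathbb{Q}(\beta,\sqrt{d})$. \end{itemize} In particular, $[\mathbb{Q}(E^d[2]):\mathbb{Q}]=2$ and $[\mathbb{Q}(E^d[4]):\mathbb{Q}]=16$; moreover $[\mathbb{Q}(E^d[8]):\mathbb{Q}]=32$ if and only if $d\in\{\pm1,\pm2\}$, and otherwise $[\mathbb{Q}(E^d[8]):\mathbb{Q}]=64$. -/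

import Mathlib

open Polynomial

/-- The curve `E^d : y² = x³ - 4320 d² x + 96768 d³` over `ℚ`. -/
def curveE (d : ℤ) : WeierstrassCurve ℚ where
  a₁ := 0
  a₂ := 0
  a₃ := 0
  a₄ := -4320 * (d : ℚ) ^ 2
  a₆ := 96768 * (d : ℚ) ^ 3

/-- The `n`-division field `ℚ(W[n])` inside an extension `Ω` of `ℚ`: the field generated over `ℚ`
by the affine coordinates of the points `P ∈ W(Ω)` with `n • P = 0`. For `Ω` algebraically closed
this is the usual division field. -/
def divisionField (W : WeierstrassCurve ℚ) (Ω : Type*) [Field Ω] [Algebra ℚ Ω] [DecidableEq Ω]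
    (n : ℕ) : IntermediateField ℚ Ω :=
  IntermediateField.adjoin ℚ
    {z : Ω | ∃ (x y : Ω) (h : (W.baseChange Ω).toAffine.Nonsingular x y),
      n • WeierstrassCurve.Affine.Point.some x y h = 0 ∧ (z = x ∨ z = y)}

/-- `f₄ = x⁸ + 6x⁴ + 1`. -/
noncomputable def f4 : ℚ[X] := X ^ 8 + 6 * X ^ 4 + 1

/-- The polynomial `f₈` of degree 32. -/
noncomputable def f8 : ℚ[X] :=
  X ^ 32 + 16 * X ^ 31 + 128 * X ^ 30 + 672 * X ^ 29 + 2544 * X ^ 28 + 7200 * X ^ 27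
    + 15352 * X ^ 26 + 24272 * X ^ 25 + 26904 * X ^ 24 + 17312 * X ^ 23 - 304 * X ^ 22
    - 11984 * X ^ 21 - 9672 * X ^ 20 - 2720 * X ^ 19 - 3592 * X ^ 18 - 7552 * X ^ 17
    - 2798 * X ^ 16 + 6224 * X ^ 15 + 6368 * X ^ 14 - 672 * X ^ 13 - 2224 * X ^ 12
    + 3360 * X ^ 11 + 4952 * X ^ 10 - 1072 * X ^ 9 - 4600 * X ^ 8 - 1120 * X ^ 7
    + 1776 * X ^ 6 + 752 * X ^ 5 - 264 * X ^ 4 - 96 * X ^ 3 + 24 * X ^ 2 + 1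

/-!
Over a field containing `r = √d` the curve `E^d` becomes `v² = u³ + 4u² + 2u`: it is the twist
`x = d(36u + 48)`, `y = 216drv` of that model. The points `(0, 0)` and `(-2 - √2, 0)` generate the
`2`-torsion, and halving generators twice gives explicit generators of the `4`- and `8`-torsion.
Reading off their coordinates shows that the division fields are towers of square roots
`s = √2`, `i = √-1`, `t = √s`, `p = √(1 + s)`, `w`, twisted by `r`. If `x + y√c` is a square in
`F(√c)`, then its norm `x² - cy²` is a square in `F`; applied repeatedly, this shows that no step
of a tower collapses, and that `√d` lies in the full tower only for `d ∈ {±1, ±2}`.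

The roots of `f₄` are, up to inversion, the elements `p(1 + i)/s`. For `f₈` put `y = 2β + 1`; then
`2³² f₈(β)` is the norm, down a tower `ℚ(s, i, t, p)`, of a quadratic polynomial in `y`. Hence each
root solves such a quadratic equation for some choice of signs of the square roots. As `y` does not
lie in `ℚ(s, i, t, p)`, two different quadratic equations would be incompatible, so `β` determines
the signs and is a primitive element of the tower.
-/

open IntermediateField WeierstrassCurve

attribute [local instance] algebraRat.charZero

section Quadratic

variable {k L : Type*} [Field k] [Field L] [Algebra k L] {S : Set L} {s : L}

theorem mem_adjoin_insert_iff (hs : s ^ 2 ∈ adjoin k S) {z : L} :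
    z ∈ adjoin k (insert s S) ↔ ∃ x ∈ adjoin k S, ∃ y ∈ adjoin k S, z = x + y * s := by
  have hmonic : (X ^ 2 - C (⟨s ^ 2, hs⟩ : adjoin k S)).Monic := monic_X_pow_sub_C _ two_ne_zero
  have heval : aeval s (X ^ 2 - C (⟨s ^ 2, hs⟩ : adjoin k S)) = 0 := by simp
  have hint : IsIntegral (adjoin k S) s := ⟨_, hmonic, heval⟩
  rw [← Set.union_singleton, ← adjoin_adjoin_left, mem_restrictScalars, ← mem_toSubalgebra,
    adjoin_simple_toSubalgebra_of_isAlgebraic hint.isAlgebraic,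
    Algebra.adjoin_singleton_eq_range_aeval]
  constructor
  · rintro ⟨f, rfl⟩
    have hdeg : (f %ₘ (X ^ 2 - C ⟨s ^ 2, hs⟩)).natDegree ≤ 1 := Nat.lt_succ_iff.mp <|
      (natDegree_modByMonic_lt f hmonic (fun h => by simpa using congrArg natDegree h)).trans_eq
        (natDegree_X_pow_sub_C)
    obtain ⟨y, x, hf⟩ := exists_eq_X_add_C_of_natDegree_le_one hdeg
    refine ⟨x, x.2, y, y.2, ?_⟩
    change aeval s f = _
    rw [← aeval_modByMonic_eq_self_of_root heval, hf]
    simp [add_comm]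
  · rintro ⟨x, hx, y, hy, rfl⟩
    exact ⟨C ⟨x, hx⟩ + C ⟨y, hy⟩ * X, by simp⟩

theorem finrank_adjoin_insert (hs : s ^ 2 ∈ adjoin k S) (hsS : s ∉ adjoin k S) :
    Module.finrank k (adjoin k (insert s S)) = 2 * Module.finrank k (adjoin k S) := by
  have hroot : aeval s (X ^ 2 - C (⟨s ^ 2, hs⟩ : adjoin k S)) = 0 := by simp
  have hirr : Irreducible (X ^ 2 - C (⟨s ^ 2, hs⟩ : adjoin k S)) := by
    rw [X_pow_sub_C_irreducible_iff_of_prime Nat.prime_two]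
    intro x hx
    rcases sq_eq_sq_iff_eq_or_eq_neg.mp (congrArg Subtype.val hx) with h | h
    · exact hsS (h ▸ x.2)
    · exact hsS (neg_mem_iff.mp (h ▸ x.2))
  have hint : IsIntegral (adjoin k S) s := ⟨_, monic_X_pow_sub_C _ two_ne_zero, hroot⟩
  have hrank : Module.finrank (adjoin k S) (adjoin k S)⟮s⟯ = 2 := by
    rw [adjoin.finrank hint, ← minpoly.eq_of_irreducible_of_monic hirr hroot
      (monic_X_pow_sub_C _ two_ne_zero), natDegree_X_pow_sub_C]
  rw [← Set.union_singleton, ← adjoin_adjoin_left, mul_comm, ← hrank]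
  exact (Module.finrank_mul_finrank k (adjoin k S) (adjoin k S)⟮s⟯).symm

theorem adjoin_insert_eq_of_mem (hs : s ∈ adjoin k S) : adjoin k (insert s S) = adjoin k S :=
  le_antisymm (adjoin_le_iff.mpr (Set.insert_subset hs (subset_adjoin k S)))
    (adjoin.mono k S _ (Set.subset_insert s S))

theorem eq_zero_of_add_mul_eq_zero {F : IntermediateField k L} (hs : s ∉ F) {x y : L} (hx : x ∈ F)
    (hy : y ∈ F) (h : x + y * s = 0) : x = 0 ∧ y = 0 := by
  have hy0 : y = 0 := by
    by_contra hy0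
    apply hs
    rw [show s = -x / y by rw [eq_div_iff hy0]; linear_combination h]
    exact div_mem (neg_mem hx) hy
  exact ⟨by simpa [hy0] using h, hy0⟩

/-- `z` is the square of an element of the subfield `F`; `z` itself need not lie in `F` a priori,
so that no coercions are needed to go up and down a tower. -/
def IsSquareIn (F : IntermediateField k L) (z : L) : Prop := ∃ x ∈ F, x ^ 2 = z

theorem IsSquareIn.of_mul_sq {F : IntermediateField k L} {c e : L} (he : e ∈ F) (he0 : e ≠ 0)
    (h : IsSquareIn F (c * e ^ 2)) : IsSquareIn F c := by
  obtain ⟨x, hx, h⟩ := h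
  exact ⟨x / e, div_mem hx he, by rw [div_pow, h, mul_div_cancel_right₀ _ (pow_ne_zero 2 he0)]⟩

theorem IsSquareIn.of_adjoin_insert [NeZero (2 : L)] (hs : s ^ 2 ∈ adjoin k S)
    (hsS : s ∉ adjoin k S) {c : L} (hc : c ∈ adjoin k S)
    (h : IsSquareIn (adjoin k (insert s S)) c) :
    IsSquareIn (adjoin k S) c ∨ IsSquareIn (adjoin k S) (c * s ^ 2) := by
  obtain ⟨z, hz, rfl⟩ := h
  obtain ⟨x, hx, y, hy, rfl⟩ := (mem_adjoin_insert_iff hs).mp hz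
  have hxy : 2 * x * y = 0 := (eq_zero_of_add_mul_eq_zero hsS
    (x := x ^ 2 + y ^ 2 * s ^ 2 - (x + y * s) ^ 2)
    (sub_mem (add_mem (pow_mem hx 2) (mul_mem (pow_mem hy 2) hs)) hc)
    (mul_mem (mul_mem (ofNat_mem _ 2) hx) hy) (by ring)).2
  rcases mul_eq_zero.mp hxy with hx0 | rfl
  · obtain rfl : x = 0 := (mul_eq_zero.mp hx0).resolve_left two_ne_zero
    exact .inr ⟨y * s ^ 2, mul_mem hy hs, by ring⟩
  · exact .inl ⟨x, hx, by ring⟩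

theorem IsSquareIn.norm (hs : s ^ 2 ∈ adjoin k S) (hsS : s ∉ adjoin k S) {x y : L}
    (hx : x ∈ adjoin k S) (hy : y ∈ adjoin k S)
    (h : IsSquareIn (adjoin k (insert s S)) (x + y * s)) :
    IsSquareIn (adjoin k S) (x ^ 2 - y ^ 2 * s ^ 2) := by
  obtain ⟨z, hz, h⟩ := h
  obtain ⟨a, ha, b, hb, rfl⟩ := (mem_adjoin_insert_iff hs).mp hz
  obtain ⟨hxab, hyab⟩ := eq_zero_of_add_mul_eq_zero hsS (x := x - (a ^ 2 + b ^ 2 * s ^ 2))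
    (y := y - 2 * a * b) (sub_mem hx (add_mem (pow_mem ha 2) (mul_mem (pow_mem hb 2) hs)))
    (sub_mem hy (mul_mem (mul_mem (ofNat_mem _ 2) ha) hb)) (by linear_combination -h)
  obtain rfl := sub_eq_zero.mp hxab
  obtain rfl := sub_eq_zero.mp hyab
  exact ⟨a ^ 2 - b ^ 2 * s ^ 2, sub_mem (pow_mem ha 2) (mul_mem (pow_mem hb 2) hs), by ring⟩

end Quadratic

section PrimitiveElement

variable {k L : Type*} [Field k] [Field L] [Algebra k L] {S : Set L} {x : L}

theorem adjoin_simple_eq_of_forall_algHom [IsAlgClosed L] [FiniteDimensional k (adjoin k S)]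
    [Algebra.IsSeparable k (adjoin k S)] (hx : x ∈ adjoin k S)
    (h : ∀ ψ : adjoin k S →ₐ[k] L, ψ ⟨x, hx⟩ = x →
      ∀ z (hz : z ∈ S), ψ ⟨z, subset_adjoin k S hz⟩ = z) : k⟮x⟯ = adjoin k S := by
  have htop : k⟮(⟨x, hx⟩ : adjoin k S)⟯ = ⊤ := by
    rw [Field.primitive_element_iff_algHom_eq_of_eval k L (fun _ => IsAlgClosed.splits _) _
      (adjoin k S).val]
    exact fun ψ hψ => algHom_ext_of_eq_adjoin _ rfl fun z hz => (h ψ hψ.symm z hz).symm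
  rw [← lift_top k (adjoin k S), ← htop, lift_adjoin_simple]

end PrimitiveElement

/-- Square roots `s = √2`, `i = √-1`, `t = ⁴√2` and `p = √(1 + √2)` generating the field of
definition of the `4`-torsion of the curve `v² = u³ + 4u² + 2u`, with compatible signs. -/
structure IsFourTower {Ω : Type*} [Field Ω] (s i t p : Ω) : Prop where
  s_sq : s ^ 2 = 2
  i_sq : i ^ 2 = -1
  t_sq : t ^ 2 = s
  p_sq : p ^ 2 = 1 + s

/-- A tower of square roots generating the field of definition of the `8`-torsion of the curve
`v² = u³ + 4u² + 2u`; `-w² / 2` is the abscissa of a point of order `8`. -/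
structure IsEightTower {Ω : Type*} [Field Ω] (s i t p w : Ω) : Prop extends
    IsFourTower s i t p where
  w_sq : w ^ 2 = 4 * p - 2 * s - 2 * s * t * (1 - p)

theorem eq_one_of_squarefree_of_isSquare {n : ℤ} (hn : Squarefree n) (h : IsSquare n) : n = 1 := by
  obtain ⟨k, rfl⟩ := h
  exact Int.isUnit_mul_self (hn k dvd_rfl)

theorem eq_two_of_squarefree_of_isSquare_two_mul {n : ℤ} (hn : Squarefree n)
    (h : IsSquare (2 * n)) : n = 2 := by
  obtain ⟨k, hk⟩ := h
  obtain ⟨l, rfl⟩ : 2 ∣ k := Int.prime_two.dvd_of_dvd_pow (n := 2) ⟨n, by rw [hk, sq]⟩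
  have hl : l * l = 1 := Int.isUnit_mul_self (hn l ⟨2, by linarith⟩)
  linarith

section SqrtTwo

variable {Ω : Type*} [Field Ω] [Algebra ℚ Ω] {s i : Ω}

theorem isSquareIn_bot_ratCast_iff {q : ℚ} :
    IsSquareIn (⊥ : IntermediateField ℚ Ω) (q : Ω) ↔ IsSquare q := by
  simp only [IsSquareIn, mem_bot, Set.exists_range_iff, eq_ratCast, isSquare_iff_exists_sq]
  norm_cast
  simp only [eq_comm]

theorem mem_adjoin_sqrt_two_iff (hs : s ^ 2 = 2) {z : Ω} :
    z ∈ ℚ⟮s⟯ ↔ ∃ a b : ℚ, z = a + b * s := by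
  have hs' : s ^ 2 ∈ adjoin ℚ (∅ : Set Ω) := hs ▸ ofNat_mem _ 2
  rw [← insert_empty_eq, mem_adjoin_insert_iff hs']
  simp [mem_bot]

theorem sqrt_two_notMem_adjoin_empty (hs : s ^ 2 = 2) : s ∉ adjoin ℚ (∅ : Set Ω) := by
  rw [adjoin_empty]
  exact fun h => absurd (isSquareIn_bot_ratCast_iff.mp ⟨s, h, hs.trans (Rat.cast_ofNat 2).symm⟩)
    (by norm_num)

theorem IsSquareIn.isSquare_or_two_mul (hs : s ^ 2 = 2) {q : ℚ} (h : IsSquareIn ℚ⟮s⟯ (q : Ω)) :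
    IsSquare q ∨ IsSquare (2 * q) := by
  rw [← insert_empty_eq] at h
  have h' := h.of_adjoin_insert (hs ▸ ofNat_mem _ 2) (sqrt_two_notMem_adjoin_empty hs)
    (SubfieldClass.ratCast_mem _ q)
  rw [adjoin_empty, hs, mul_comm] at h'
  exact h'.imp isSquareIn_bot_ratCast_iff.mp fun h => isSquareIn_bot_ratCast_iff.mp (mod_cast h)

theorem IsSquareIn.isSquare_norm (hs : s ^ 2 = 2) {a b : ℚ} (h : IsSquareIn ℚ⟮s⟯ (a + b * s)) :
    IsSquare (a ^ 2 - b ^ 2 * 2) := by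
  rw [← insert_empty_eq] at h
  have h' := h.norm (hs ▸ ofNat_mem _ 2) (sqrt_two_notMem_adjoin_empty hs)
    (SubfieldClass.ratCast_mem _ a) (SubfieldClass.ratCast_mem _ b)
  rw [adjoin_empty, hs] at h'
  exact isSquareIn_bot_ratCast_iff.mp (mod_cast h')

theorem finrank_adjoin_sqrt_two (hs : s ^ 2 = 2) : Module.finrank ℚ ℚ⟮s⟯ = 2 := by
  rw [← insert_empty_eq, finrank_adjoin_insert (hs ▸ ofNat_mem _ 2)
    (sqrt_two_notMem_adjoin_empty hs), adjoin_empty, IntermediateField.finrank_bot]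

theorem sqrt_neg_one_notMem (hs : s ^ 2 = 2) (hi : i ^ 2 = -1) : i ∉ ℚ⟮s⟯ := fun h => by
  have h' : IsSquareIn ℚ⟮s⟯ ((-1 : ℚ) : Ω) := ⟨i, h, by simpa using hi⟩
  rcases h'.isSquare_or_two_mul hs with h | h <;> exact absurd h.nonneg (by norm_num)

theorem sqrt_neg_one_sq_mem (hi : i ^ 2 = -1) {K : IntermediateField ℚ Ω} : i ^ 2 ∈ K :=
  hi ▸ neg_mem (one_mem K)

theorem finrank_adjoin_sqrt_neg_one (hs : s ^ 2 = 2) (hi : i ^ 2 = -1) :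
    Module.finrank ℚ ℚ⟮i, s⟯ = 4 := by
  rw [finrank_adjoin_insert (sqrt_neg_one_sq_mem hi) (sqrt_neg_one_notMem hs hi),
    finrank_adjoin_sqrt_two hs]

theorem IsSquareIn.isSquareIn_or_neg (hs : s ^ 2 = 2) (hi : i ^ 2 = -1) {z : Ω} (hz : z ∈ ℚ⟮s⟯)
    (h : IsSquareIn ℚ⟮i, s⟯ z) : IsSquareIn ℚ⟮s⟯ z ∨ IsSquareIn ℚ⟮s⟯ (-z) := by
  have h' := h.of_adjoin_insert (sqrt_neg_one_sq_mem hi) (sqrt_neg_one_notMem hs hi) hz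
  rwa [hi, mul_neg_one] at h'

theorem IsSquareIn.isSquare_norm_of_sqrt_neg_one (hs : s ^ 2 = 2) (hi : i ^ 2 = -1) {a b : ℚ}
    (h : IsSquareIn ℚ⟮i, s⟯ (a + b * s)) : IsSquare (a ^ 2 - b ^ 2 * 2) := by
  rcases h.isSquareIn_or_neg hs hi ((mem_adjoin_sqrt_two_iff hs).mpr ⟨a, b, rfl⟩) with h | h
  · exact h.isSquare_norm hs
  · rw [← neg_sq a, ← neg_sq b]
    refine IsSquareIn.isSquare_norm hs ?_
    convert h using 1
    push_cast
    ring

end SqrtTwo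

namespace IsFourTower

variable {Ω : Type*} [Field Ω] [Algebra ℚ Ω] {s i t p : Ω} {e : ℚ}

theorem t_sq_mem (h : IsFourTower s i t p) : t ^ 2 ∈ ℚ⟮i, s⟯ :=
  h.t_sq ▸ subset_adjoin ℚ _ (by simp)

theorem p_sq_mem (h : IsFourTower s i t p) {S : Set Ω} (hS : s ∈ S) : p ^ 2 ∈ adjoin ℚ S :=
  h.p_sq ▸ add_mem (one_mem _) (subset_adjoin ℚ _ hS)

theorem not_isSquareIn_mul_s (h : IsFourTower s i t p) (he : e ≠ 0) :
    ¬IsSquareIn ℚ⟮i, s⟯ (e * s) := fun hsq => by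
  have hnorm := IsSquareIn.isSquare_norm_of_sqrt_neg_one h.s_sq h.i_sq (a := 0) (b := e)
    (by simpa using hsq)
  nlinarith [hnorm.nonneg, sq_pos_of_ne_zero he]

theorem not_isSquareIn_mul_one_add_s (h : IsFourTower s i t p) (he : e ≠ 0) :
    ¬IsSquareIn ℚ⟮i, s⟯ (e * (1 + s)) := fun hsq => by
  have hnorm := IsSquareIn.isSquare_norm_of_sqrt_neg_one h.s_sq h.i_sq (a := e) (b := e)
    (by simpa [mul_add] using hsq)
  nlinarith [hnorm.nonneg, sq_pos_of_ne_zero he]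

theorem not_isSquareIn_mul_two_add_s (h : IsFourTower s i t p) (he : e ≠ 0) :
    ¬IsSquareIn ℚ⟮i, s⟯ (e * (2 + s)) := fun hsq => by
  have hnorm := IsSquareIn.isSquare_norm_of_sqrt_neg_one h.s_sq h.i_sq (a := 2 * e) (b := e)
    (by convert hsq using 1; push_cast; ring)
  obtain ⟨x, hx⟩ := hnorm
  have htwo : IsSquare (2 : ℚ) := ⟨x / e, by field_simp; linear_combination hx⟩
  exact absurd htwo (by norm_num)

theorem t_notMem (h : IsFourTower s i t p) : t ∉ ℚ⟮i, s⟯ := fun ht =>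
  h.not_isSquareIn_mul_s one_ne_zero ⟨t, ht, by simp [h.t_sq]⟩

theorem p_notMem_adjoin_sqrt (h : IsFourTower s i t p) : p ∉ ℚ⟮i, s⟯ := fun hp =>
  h.not_isSquareIn_mul_one_add_s one_ne_zero ⟨p, hp, by simp [h.p_sq]⟩

theorem not_isSquareIn_adjoin_t (h : IsFourTower s i t p) (he : e ≠ 0) :
    ¬IsSquareIn ℚ⟮t, i, s⟯ (e * (1 + s)) := fun hsq => by
  have hmem : (e : Ω) * (1 + s) ∈ ℚ⟮i, s⟯ := mul_mem (SubfieldClass.ratCast_mem _ e)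
    (add_mem (one_mem _) (subset_adjoin ℚ _ (by simp)))
  rcases hsq.of_adjoin_insert h.t_sq_mem h.t_notMem hmem with hsq | hsq
  · exact h.not_isSquareIn_mul_one_add_s he hsq
  · rw [show e * (1 + s) * t ^ 2 = e * (2 + s) by rw [h.t_sq]; linear_combination e * h.s_sq] at hsq
    exact h.not_isSquareIn_mul_two_add_s he hsq

theorem p_notMem (h : IsFourTower s i t p) : p ∉ ℚ⟮t, i, s⟯ := fun hp =>
  h.not_isSquareIn_adjoin_t one_ne_zero ⟨p, hp, by simp [h.p_sq]⟩

theorem isSquare_or_of_isSquareIn (h : IsFourTower s i t p) {q : ℚ} (hq : q ≠ 0)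
    (hsq : IsSquareIn ℚ⟮p, t, i, s⟯ (q : Ω)) :
    IsSquare q ∨ IsSquare (2 * q) ∨ IsSquare (-q) ∨ IsSquare (2 * -q) := by
  have hsq : IsSquareIn ℚ⟮t, i, s⟯ (q : Ω) := by
    refine (hsq.of_adjoin_insert (h.p_sq_mem (by simp)) h.p_notMem
      (SubfieldClass.ratCast_mem _ q)).resolve_right ?_
    exact h.p_sq ▸ h.not_isSquareIn_adjoin_t hq
  have hsq : IsSquareIn ℚ⟮i, s⟯ (q : Ω) := by
    refine (hsq.of_adjoin_insert h.t_sq_mem h.t_notMem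
      (SubfieldClass.ratCast_mem _ q)).resolve_right ?_
    exact h.t_sq ▸ h.not_isSquareIn_mul_s hq
  rcases hsq.isSquareIn_or_neg h.s_sq h.i_sq (SubfieldClass.ratCast_mem _ q) with hsq | hsq
  · exact (hsq.isSquare_or_two_mul h.s_sq).imp_right .inl
  · rw [← Rat.cast_neg] at hsq
    exact .inr (.inr (hsq.isSquare_or_two_mul h.s_sq))

theorem finrank_adjoin_p (h : IsFourTower s i t p) : Module.finrank ℚ ℚ⟮p, i, s⟯ = 8 := by
  rw [finrank_adjoin_insert (h.p_sq_mem (by simp)) h.p_notMem_adjoin_sqrt,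
    finrank_adjoin_sqrt_neg_one h.s_sq h.i_sq]

theorem finrank_adjoin_mul_t (h : IsFourTower s i t p) {d : ℤ} (hd : d ≠ 0) {r : Ω}
    (hr : r ^ 2 = d) : Module.finrank ℚ ℚ⟮r * t, p, i, s⟯ = 16 := by
  have hrt : (r * t) ^ 2 = (d : ℚ) * s := by rw [mul_pow, hr, h.t_sq, Rat.cast_intCast]
  have hd' : (d : ℚ) ≠ 0 := Int.cast_ne_zero.mpr hd
  have hmem {S : Set Ω} (hS : s ∈ S) : ((d : ℚ) : Ω) * s ∈ adjoin ℚ S :=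
    mul_mem (SubfieldClass.ratCast_mem _ _) (subset_adjoin ℚ _ hS)
  rw [finrank_adjoin_insert (hrt ▸ hmem (by simp)), h.finrank_adjoin_p]
  intro hrtO
  have hsq : IsSquareIn ℚ⟮p, i, s⟯ ((d : ℚ) * s) := ⟨r * t, hrtO, hrt⟩
  rcases hsq.of_adjoin_insert (h.p_sq_mem (by simp)) h.p_notMem_adjoin_sqrt (hmem (by simp)) with
    hsq | hsq
  · exact h.not_isSquareIn_mul_s hd' hsq
  · rw [h.p_sq, show (d : ℚ) * s * (1 + s) = (d : ℚ) * (2 + s) by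
      linear_combination (d : ℚ) * h.s_sq] at hsq
    exact h.not_isSquareIn_mul_two_add_s hd' hsq

end IsFourTower

namespace IsEightTower

variable {Ω : Type*} [Field Ω] [Algebra ℚ Ω] {s i t p w : Ω}

theorem w_sq_mem (h : IsEightTower s i t p w) : w ^ 2 ∈ ℚ⟮p, t, i, s⟯ := by
  have hp : p ∈ ℚ⟮p, t, i, s⟯ := subset_adjoin ℚ _ (by simp)
  have ht : t ∈ ℚ⟮p, t, i, s⟯ := subset_adjoin ℚ _ (by simp)
  have hs : s ∈ ℚ⟮p, t, i, s⟯ := subset_adjoin ℚ _ (by simp)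
  generalize ℚ⟮p, t, i, s⟯ = K at *
  rw [h.w_sq]
  aesop

theorem not_isSquareIn_mul_w_sq (h : IsEightTower s i t p w) {e : ℚ} (he : e ≠ 0) :
    ¬IsSquareIn ℚ⟮p, t, i, s⟯ (e * w ^ 2) := fun hsq => by
  have htN : t ∈ ℚ⟮t, i, s⟯ := subset_adjoin ℚ _ (by simp)
  have hiN : i ∈ ℚ⟮t, i, s⟯ := subset_adjoin ℚ _ (by simp)
  have hsN : s ∈ ℚ⟮t, i, s⟯ := subset_adjoin ℚ _ (by simp)
  have heN : (e : Ω) ∈ ℚ⟮t, i, s⟯ := SubfieldClass.ratCast_mem _ e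
  have he' : (e : Ω) ≠ 0 := Rat.cast_ne_zero.mpr he
  have hst : 2 * s * t ∈ ℚ⟮t, i, s⟯ := mul_mem (mul_mem (ofNat_mem _ 2) hsN) htN
  have hx : -2 * s - 2 * s * t ∈ ℚ⟮t, i, s⟯ :=
    sub_mem (mul_mem (neg_mem (ofNat_mem _ 2)) hsN) hst
  have hy : 4 + 2 * s * t ∈ ℚ⟮t, i, s⟯ := add_mem (ofNat_mem _ 4) hst
  have hroot : 2 * i * s * (1 + t) ∈ ℚ⟮t, i, s⟯ :=
    mul_mem (mul_mem (mul_mem (ofNat_mem _ 2) hiN) hsN) (add_mem (one_mem _) htN)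
  have h4 := h.toIsFourTower
  obtain ⟨⟨hs, hi, ht, hp⟩, hw⟩ := h
  rw [show e * w ^ 2 = e * (-2 * s - 2 * s * t) + e * (4 + 2 * s * t) * p by
    rw [hw]; ring] at hsq
  have hnorm := hsq.norm (h4.p_sq_mem (by simp)) h4.p_notMem (mul_mem heN hx) (mul_mem heN hy)
  have hfactor : (-2 * s - 2 * s * t) ^ 2 - (4 + 2 * s * t) ^ 2 * p ^ 2 =
    (1 + s) * (2 * i * s * (1 + t)) ^ 2 := by grind
  rw [show (e * (-2 * s - 2 * s * t)) ^ 2 - (e * (4 + 2 * s * t)) ^ 2 * p ^ 2 =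
    (1 + s) * (e * (2 * i * s * (1 + t))) ^ 2 by
      linear_combination (e : Ω) ^ 2 * hfactor] at hnorm
  refine h4.not_isSquareIn_adjoin_t one_ne_zero ?_
  simpa using hnorm.of_mul_sq (mul_mem heN hroot) (mul_ne_zero he' (by grind))

theorem w_notMem (h : IsEightTower s i t p w) : w ∉ ℚ⟮p, t, i, s⟯ := fun hw =>
  h.not_isSquareIn_mul_w_sq one_ne_zero ⟨w, hw, by simp⟩

theorem finrank_adjoin (h : IsEightTower s i t p w) :
    Module.finrank ℚ ℚ⟮w, p, t, i, s⟯ = 32 := by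
  rw [finrank_adjoin_insert h.w_sq_mem h.w_notMem,
    finrank_adjoin_insert (h.p_sq_mem (by simp)) h.p_notMem,
    finrank_adjoin_insert h.t_sq_mem h.t_notMem, finrank_adjoin_sqrt_neg_one h.s_sq h.i_sq]

theorem finiteDimensional_adjoin (h : IsEightTower s i t p w) :
    FiniteDimensional ℚ ℚ⟮w, p, t, i, s⟯ :=
  Module.finite_of_finrank_pos (h.finrank_adjoin ▸ by decide)

theorem sqrt_mem_iff (h : IsEightTower s i t p w) {d : ℤ} (hd : Squarefree d) {r : Ω}
    (hr : r ^ 2 = d) : r ∈ ℚ⟮w, p, t, i, s⟯ ↔ d = 1 ∨ d = -1 ∨ d = 2 ∨ d = -2 := by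
  constructor
  · intro hrL
    have hd' : (d : ℚ) ≠ 0 := Int.cast_ne_zero.mpr hd.ne_zero
    have hsq : IsSquareIn ℚ⟮w, p, t, i, s⟯ ((d : ℚ) : Ω) := ⟨r, hrL, by simp [hr]⟩
    have hsq : IsSquareIn ℚ⟮p, t, i, s⟯ ((d : ℚ) : Ω) :=
      (hsq.of_adjoin_insert h.w_sq_mem h.w_notMem
        (SubfieldClass.ratCast_mem _ _)).resolve_right (h.not_isSquareIn_mul_w_sq hd')
    have hsquare := h.isSquare_or_of_isSquareIn hd' hsq
    norm_cast at hsquare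
    have hneg : Squarefree (-d) := fun x hx => hd x (dvd_neg.mp hx)
    rcases hsquare with hsquare | hsquare | hsquare | hsquare
    · exact .inl (eq_one_of_squarefree_of_isSquare hd hsquare)
    · exact .inr (.inr (.inl (eq_two_of_squarefree_of_isSquare_two_mul hd hsquare)))
    · exact .inr (.inl (neg_eq_iff_eq_neg.mp (eq_one_of_squarefree_of_isSquare hneg hsquare)))
    · exact .inr (.inr (.inr (neg_eq_iff_eq_neg.mp
        (eq_two_of_squarefree_of_isSquare_two_mul hneg hsquare))))
  · have hi : i ∈ ℚ⟮w, p, t, i, s⟯ := subset_adjoin ℚ _ (by simp)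
    have hs : s ∈ ℚ⟮w, p, t, i, s⟯ := subset_adjoin ℚ _ (by simp)
    have of_sq {z : Ω} (hz : z ∈ ℚ⟮w, p, t, i, s⟯) (hzd : z ^ 2 = d) : r ∈ ℚ⟮w, p, t, i, s⟯ := by
      rcases sq_eq_sq_iff_eq_or_eq_neg.mp (hr.trans hzd.symm) with rfl | rfl
      exacts [hz, neg_mem hz]
    rintro (rfl | rfl | rfl | rfl)
    · exact of_sq (one_mem _) (by simp)
    · exact of_sq hi (by simp [h.i_sq])
    · exact of_sq hs (by simp [h.s_sq])
    · exact of_sq (mul_mem hi hs) (by rw [mul_pow, h.i_sq, h.s_sq]; simp)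

end IsEightTower

theorem torsionBy_mul_eq {G : Type*} [AddCommGroup G] {m n : ℕ} (hmn : m ∣ n)
    {H : AddSubgroup G} (h : H.map (nsmulAddMonoidHom m) = AddSubgroup.torsionBy G n) :
    AddSubgroup.torsionBy G (m * n : ℕ) = H := by
  ext R
  rw [AddSubgroup.torsionBy.nsmul_iff]
  constructor
  · intro hR
    obtain ⟨S, hS, hSR⟩ : m • R ∈ H.map (nsmulAddMonoidHom m) := by
      rwa [h, AddSubgroup.torsionBy.nsmul_iff, ← mul_nsmul]
    have hdiff : R - S ∈ H.map (nsmulAddMonoidHom m) := by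
      obtain ⟨c, rfl⟩ := hmn
      rw [h, AddSubgroup.torsionBy.nsmul_iff, mul_nsmul, nsmul_sub]
      simp_all
    obtain ⟨T, hT, hTR⟩ := hdiff
    rw [← sub_add_cancel R S, ← hTR]
    exact add_mem (nsmul_mem hT m) hS
  · intro hR
    rw [mul_nsmul, ← AddSubgroup.torsionBy.nsmul_iff, ← h]
    exact ⟨R, hR, rfl⟩

theorem torsionBy_two_mul_eq_closure {G : Type*} [AddCommGroup G] {n : ℕ} (hn : 2 ∣ n)
    {P Q P' Q' : G} (h : AddSubgroup.torsionBy G n = AddSubgroup.closure {P, Q})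
    (hP : 2 • P' = P) (hQ : 2 • Q' = Q) :
    AddSubgroup.torsionBy G (2 * n : ℕ) = AddSubgroup.closure {P', Q'} := by
  apply torsionBy_mul_eq hn
  rw [h, AddMonoidHom.map_closure, Set.image_pair, nsmulAddMonoidHom_apply,
    nsmulAddMonoidHom_apply, hP, hQ]

section DivisionField

variable {Ω : Type*} [Field Ω] [Algebra ℚ Ω] [DecidableEq Ω] {W : WeierstrassCurve ℚ}

/-- The subgroup of `W(Ω)` consisting of the points with coordinates in the subfield `K`. -/
noncomputable def rationalPoints (W : WeierstrassCurve ℚ) (K : IntermediateField ℚ Ω) :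
    AddSubgroup (W.baseChange Ω).toAffine.Point :=
  (Affine.Point.map (W' := W) (algebraMap K Ω).toRatAlgHom).range

theorem some_mem_rationalPoints_iff {K : IntermediateField ℚ Ω} {x y : Ω}
    (h : (W.baseChange Ω).toAffine.Nonsingular x y) :
    Affine.Point.some x y h ∈ rationalPoints W K ↔ x ∈ K ∧ y ∈ K := by
  constructor
  · rintro ⟨_ | ⟨x', y', h'⟩, hP⟩
    · exact absurd hP.symm (Affine.Point.some_ne_zero h)
    · rw [Affine.Point.map_some, Affine.Point.some.injEq] at hP
      exact ⟨hP.1 ▸ x'.2, hP.2 ▸ y'.2⟩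
  · rintro ⟨hx, hy⟩
    exact ⟨.some ⟨x, hx⟩ ⟨y, hy⟩ ((Affine.baseChange_nonsingular W
      (f := (algebraMap K Ω).toRatAlgHom) (algebraMap K Ω).toRatAlgHom.injective
      ⟨x, hx⟩ ⟨y, hy⟩).mp h), rfl⟩

theorem divisionField_le_iff_torsionBy_le {K : IntermediateField ℚ Ω} {n : ℕ} :
    divisionField W Ω n ≤ K ↔
      AddSubgroup.torsionBy (W.baseChange Ω).toAffine.Point n ≤ rationalPoints W K := by
  rw [divisionField, adjoin_le_iff]
  constructor
  · rintro hK (_ | ⟨x, y, h⟩) hP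
    · exact zero_mem _
    · rw [AddSubgroup.torsionBy.nsmul_iff] at hP
      exact (some_mem_rationalPoints_iff h).mpr
        ⟨hK ⟨x, y, h, hP, .inl rfl⟩, hK ⟨x, y, h, hP, .inr rfl⟩⟩
  · rintro hK z ⟨x, y, h, hP, hz⟩
    obtain ⟨hx, hy⟩ := (some_mem_rationalPoints_iff h).mp
      (hK (AddSubgroup.torsionBy.nsmul_iff.mpr hP))
    rcases hz with rfl | rfl
    exacts [hx, hy]

theorem divisionField_le_iff_of_torsionBy_eq_closure {K : IntermediateField ℚ Ω} {n : ℕ}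
    {P Q : (W.baseChange Ω).toAffine.Point}
    (h : AddSubgroup.torsionBy (W.baseChange Ω).toAffine.Point n = AddSubgroup.closure {P, Q}) :
    divisionField W Ω n ≤ K ↔ P ∈ rationalPoints W K ∧ Q ∈ rationalPoints W K := by
  rw [divisionField_le_iff_torsionBy_le, h, AddSubgroup.closure_le, Set.insert_subset_iff,
    Set.singleton_subset_iff, SetLike.mem_coe, SetLike.mem_coe]

theorem divisionField_mono {m n : ℕ} (h : m ∣ n) : divisionField W Ω m ≤ divisionField W Ω n := by
  obtain ⟨c, rfl⟩ := h
  refine adjoin.mono _ _ _ ?_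
  rintro z ⟨x, y, h, hn, hz⟩
  exact ⟨x, y, h, by rw [mul_nsmul, hn, nsmul_zero], hz⟩

end DivisionField

namespace curveE

variable {Ω : Type*} [Field Ω] [Algebra ℚ Ω] {d : ℤ}

/-- The curve `E^d` over the extension `Ω` of `ℚ`, in affine coordinates. -/
abbrev overField (d : ℤ) (Ω : Type*) [Field Ω] [Algebra ℚ Ω] : WeierstrassCurve.Affine Ω :=
  ((curveE d).baseChange Ω).toAffine

theorem a₁_overField : (overField d Ω).a₁ = 0 := by simp [overField, curveE]

theorem a₂_overField : (overField d Ω).a₂ = 0 := by simp [overField, curveE]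

theorem a₃_overField : (overField d Ω).a₃ = 0 := by simp [overField, curveE]

theorem a₄_overField : (overField d Ω).a₄ = -4320 * (d : Ω) ^ 2 := by
  simp [overField, curveE]

theorem a₆_overField : (overField d Ω).a₆ = 96768 * (d : Ω) ^ 3 := by
  simp [overField, curveE]

theorem negY_overField (x y : Ω) : (overField d Ω).negY x y = -y := by
  rw [Affine.negY, a₁_overField, a₃_overField]
  ring

theorem nonsingular_iff (hd : d ≠ 0) {x y : Ω} :
    (overField d Ω).Nonsingular x y ↔
      y ^ 2 = x ^ 3 - 4320 * (d : Ω) ^ 2 * x + 96768 * (d : Ω) ^ 3 := by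
  have hΔ : (overField d Ω).Δ = 1114512556032 * (d : Ω) ^ 6 := by
    simp only [WeierstrassCurve.Δ, b₂, b₄, b₆, b₈, a₁_overField, a₂_overField, a₃_overField,
      a₄_overField, a₆_overField]
    ring
  rw [← Affine.equation_iff_nonsingular_of_Δ_ne_zero (by simp [hΔ, hd]), Affine.equation_iff,
    a₁_overField, a₂_overField, a₃_overField, a₄_overField, a₆_overField]
  ring_nf

theorem sqrt_ne_zero (hd : d ≠ 0) {r : Ω} (hr : r ^ 2 = d) : r ≠ 0 := by
  rintro rfl
  simp [eq_comm, hd] at hr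

theorem nonsingular_of_model (hd : d ≠ 0) {r u v : Ω} (hr : r ^ 2 = d)
    (h : v ^ 2 = u ^ 3 + 4 * u ^ 2 + 2 * u) :
    (overField d Ω).Nonsingular (d * (36 * u + 48)) (216 * d * r * v) := by
  rw [nonsingular_iff hd]
  linear_combination 46656 * (d : Ω) ^ 2 * r ^ 2 * h +
    46656 * (d : Ω) ^ 2 * (u ^ 3 + 4 * u ^ 2 + 2 * u) * hr

/-- The point of `E^d` corresponding to the point `(u, v)` of the curve `v² = u³ + 4u² + 2u`, of
which `E^d` is the twist by `r = √d`. -/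
def twistPoint (hd : d ≠ 0) {r u v : Ω} (hr : r ^ 2 = d)
    (h : v ^ 2 = u ^ 3 + 4 * u ^ 2 + 2 * u) : (overField d Ω).Point :=
  .some (d * (36 * u + 48)) (216 * d * r * v) (nonsingular_of_model hd hr h)

theorem eq_zero_or_exists_eq_twistPoint (hd : d ≠ 0) {r : Ω} (hr : r ^ 2 = d)
    (R : (overField d Ω).Point) :
    R = 0 ∨ ∃ (u v : Ω) (h : v ^ 2 = u ^ 3 + 4 * u ^ 2 + 2 * u), R = twistPoint hd hr h := by
  have hd' : (d : Ω) ≠ 0 := Int.cast_ne_zero.mpr hd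
  have hr0 := sqrt_ne_zero hd hr
  rcases R with _ | ⟨x, y, hxy⟩
  · exact .inl rfl
  · refine .inr ⟨(x / d - 48) / 36, y / (216 * d * r), ?_, ?_⟩
    · have hcurve := (nonsingular_iff hd).mp hxy
      field_simp
      linear_combination 46656 * d * hcurve -
        46656 * (x ^ 3 - 4320 * (d : Ω) ^ 2 * x + 96768 * (d : Ω) ^ 3) * hr
    · simp only [twistPoint, Affine.Point.some.injEq]
      constructor
      · field_simp
        ring
      · field_simp

variable [DecidableEq Ω]

theorem twistPoint_mem_rationalPoints_iff (hd : d ≠ 0) {r u v : Ω} (hr : r ^ 2 = d)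
    (h : v ^ 2 = u ^ 3 + 4 * u ^ 2 + 2 * u) {K : IntermediateField ℚ Ω} :
    twistPoint hd hr h ∈ rationalPoints (curveE d) K ↔ u ∈ K ∧ r * v ∈ K := by
  have hd' : (d : Ω) ≠ 0 := Int.cast_ne_zero.mpr hd
  rw [twistPoint, some_mem_rationalPoints_iff]
  refine and_congr ⟨fun hx => ?_, fun hu => by aesop⟩ ⟨fun hy => ?_, fun hrv => ?_⟩
  · rw [show u = (d * (36 * u + 48) / d - 48) / 36 by field_simp; ring]
    exact div_mem (sub_mem (div_mem hx (intCast_mem _ _)) (ofNat_mem _ _)) (ofNat_mem _ _)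
  · rw [show r * v = 216 * d * r * v / (216 * d) by field_simp]
    exact div_mem hy (mul_mem (ofNat_mem _ _) (intCast_mem _ _))
  · rw [mul_assoc]
    exact mul_mem (mul_mem (ofNat_mem _ _) (intCast_mem _ _)) hrv

theorem two_nsmul_twistPoint_eq_zero_iff (hd : d ≠ 0) {r u v : Ω} (hr : r ^ 2 = d)
    (h : v ^ 2 = u ^ 3 + 4 * u ^ 2 + 2 * u) : 2 • twistPoint hd hr h = 0 ↔ v = 0 := by
  have hr0 := sqrt_ne_zero hd hr
  rw [two_nsmul, add_eq_zero_iff_eq_neg, twistPoint, Affine.Point.neg_some,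
    Affine.Point.some.injEq, negY_overField]
  simp [self_eq_neg, hd, hr0]

theorem two_nsmul_twistPoint (hd : d ≠ 0) {r u v u' v' l : Ω} (hr : r ^ 2 = d)
    (h : v ^ 2 = u ^ 3 + 4 * u ^ 2 + 2 * u) (h' : v' ^ 2 = u' ^ 3 + 4 * u' ^ 2 + 2 * u')
    (hv : v ≠ 0) (hl : 2 * v * l = 3 * u ^ 2 + 8 * u + 2) (hu' : u' = l ^ 2 - 4 - 2 * u)
    (hv' : v' = -(l * (u' - u) + v)) : 2 • twistPoint hd hr h = twistPoint hd hr h' := by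
  have hd' : (d : Ω) ≠ 0 := Int.cast_ne_zero.mpr hd
  have hr0 := sqrt_ne_zero hd hr
  have hne : 216 * d * r * v ≠
      (overField d Ω).negY (d * (36 * u + 48)) (216 * d * r * v) := by
    rw [negY_overField, Ne, self_eq_neg]
    simp [hd, hr0, hv]
  have hslope : (overField d Ω).slope (d * (36 * u + 48)) (d * (36 * u + 48))
      (216 * d * r * v) (216 * d * r * v) = 6 * r * l := by
    rw [Affine.slope_of_Y_ne rfl hne, negY_overField,
      div_eq_iff (by simp [← two_mul, hd', hr0, hv])]
    simp only [a₁_overField, a₂_overField, a₄_overField]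
    linear_combination (-1296 * (d : Ω) ^ 2) * hl - 2592 * d * l * v * hr
  rw [two_nsmul, twistPoint, Affine.Point.add_self_of_Y_ne hne, twistPoint,
    Affine.Point.some.injEq, hslope]
  simp only [Affine.addX, Affine.addY, Affine.negAddY, negY_overField, a₁_overField, a₂_overField]
  subst hu' hv'
  constructor
  · linear_combination 36 * l ^ 2 * hr
  · linear_combination (-216) * r * l ^ 3 * hr

theorem twistPoint_add_twistPoint (hd : d ≠ 0) {r u u' u'' : Ω} (hr : r ^ 2 = d)
    (h : (0 : Ω) ^ 2 = u ^ 3 + 4 * u ^ 2 + 2 * u) (h' : (0 : Ω) ^ 2 = u' ^ 3 + 4 * u' ^ 2 + 2 * u')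
    (h'' : (0 : Ω) ^ 2 = u'' ^ 3 + 4 * u'' ^ 2 + 2 * u'') (hne : u ≠ u')
    (hsum : u + u' + u'' = -4) :
    twistPoint hd hr h + twistPoint hd hr h' = twistPoint hd hr h'' := by
  have hx : d * (36 * u + 48) ≠ (d : Ω) * (36 * u' + 48) := by simpa [hd] using hne
  have hslope : (overField d Ω).slope (d * (36 * u + 48)) (d * (36 * u' + 48))
      (216 * d * r * 0) (216 * d * r * 0) = 0 := by
    rw [Affine.slope_of_X_ne hx, sub_self, zero_div]
  rw [twistPoint, twistPoint, twistPoint, Affine.Point.add_some fun h => hx h.1,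
    Affine.Point.some.injEq, hslope]
  simp only [Affine.addX, Affine.addY, Affine.negAddY, negY_overField, a₁_overField, a₂_overField]
  constructor
  · linear_combination (-36) * (d : Ω) * hsum
  · ring

theorem two_torsion_abscissa {k : Type*} [Field k] {u s : k} (hs : s ^ 2 = 2)
    (h : 0 = u ^ 3 + 4 * u ^ 2 + 2 * u) : u = 0 ∨ u = -2 - s ∨ u = -2 + s := by
  have hprod : u * (u - (-2 - s)) * (u - (-2 + s)) = 0 := by linear_combination -h - u * hs
  simpa only [mul_eq_zero, sub_eq_zero, or_assoc] using hprod

theorem exists_torsionBy_two_eq_closure (hd : d ≠ 0) {r s : Ω} (hr : r ^ 2 = d)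
    (hs : s ^ 2 = 2) :
    ∃ (hP : (0 : Ω) ^ 2 = 0 ^ 3 + 4 * 0 ^ 2 + 2 * 0)
      (hQ : (0 : Ω) ^ 2 = (-2 - s) ^ 3 + 4 * (-2 - s) ^ 2 + 2 * (-2 - s)),
      AddSubgroup.torsionBy (overField d Ω).Point (2 : ℕ) =
        AddSubgroup.closure {twistPoint hd hr hP, twistPoint hd hr hQ} := by
  have hP : (0 : Ω) ^ 2 = 0 ^ 3 + 4 * 0 ^ 2 + 2 * 0 := by ring
  have hQ : (0 : Ω) ^ 2 = (-2 - s) ^ 3 + 4 * (-2 - s) ^ 2 + 2 * (-2 - s) := by grind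
  refine ⟨hP, hQ, ?_⟩
  ext R
  rw [AddSubgroup.torsionBy.nsmul_iff, AddSubgroup.mem_closure_pair]
  constructor
  · intro hR
    rcases eq_zero_or_exists_eq_twistPoint hd hr R with rfl | ⟨u, v, h, rfl⟩
    · exact ⟨0, 0, by simp⟩
    obtain rfl := (two_nsmul_twistPoint_eq_zero_iff hd hr h).mp hR
    rcases two_torsion_abscissa hs (by simpa using h) with rfl | rfl | rfl
    · exact ⟨1, 0, by simp⟩
    · exact ⟨0, 1, by simp⟩
    · have hs2 : 0 ≠ -2 - s := by grind
      refine ⟨1, 1, ?_⟩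
      rw [one_zsmul, one_zsmul]
      exact twistPoint_add_twistPoint hd hr hP hQ h hs2 (by ring)
  · rintro ⟨a, b, rfl⟩
    rw [nsmul_add, smul_comm, (two_nsmul_twistPoint_eq_zero_iff hd hr hP).mpr rfl, smul_comm,
      (two_nsmul_twistPoint_eq_zero_iff hd hr hQ).mpr rfl, smul_zero, smul_zero, add_zero]

end curveE

open curveE

section TorsionGenerators

variable {Ω : Type*} [Field Ω] [Algebra ℚ Ω] [DecidableEq Ω] {d : ℤ} {r s i t p w : Ω}

theorem IsFourTower.exists_torsionBy_four_eq_closure (h : IsFourTower s i t p) (hd : d ≠ 0)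
    (hr : r ^ 2 = d) :
    ∃ (hP : (2 * t * p) ^ 2 = s ^ 3 + 4 * s ^ 2 + 2 * s)
      (hQ : ((2 * p - 2 - s) * (i * s * t)) ^ 2 =
        (2 * p - 2 - s) ^ 3 + 4 * (2 * p - 2 - s) ^ 2 + 2 * (2 * p - 2 - s)),
      AddSubgroup.torsionBy (overField d Ω).Point (4 : ℕ) =
        AddSubgroup.closure {twistPoint hd hr hP, twistPoint hd hr hQ} := by
  obtain ⟨_, _, h2⟩ := exists_torsionBy_two_eq_closure hd hr h.s_sq
  obtain ⟨hs, hi, ht, hp⟩ := h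
  refine ⟨by grind, by grind, torsionBy_two_mul_eq_closure dvd_rfl h2 ?_ ?_⟩
  · apply two_nsmul_twistPoint (l := s * t * p) <;> grind
  · apply two_nsmul_twistPoint (l := i * s * t - i * t * p) <;> grind

theorem IsEightTower.exists_torsionBy_eight_eq_closure (h : IsEightTower s i t p w) (hd : d ≠ 0)
    (hr : r ^ 2 = d) {c : Ω} (hc : c = w ^ 2 / 2 - 2 - i * (1 - p) * w) :
    ∃ (hP : (w ^ 2 / 2 * (s * (1 - p))) ^ 2 =
        (-w ^ 2 / 2) ^ 3 + 4 * (-w ^ 2 / 2) ^ 2 + 2 * (-w ^ 2 / 2))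
      (hQ : (-(c * w)) ^ 2 = c ^ 3 + 4 * c ^ 2 + 2 * c),
      AddSubgroup.torsionBy (overField d Ω).Point (8 : ℕ) =
        AddSubgroup.closure {twistPoint hd hr hP, twistPoint hd hr hQ} := by
  obtain ⟨_, _, h4⟩ := h.toIsFourTower.exists_torsionBy_four_eq_closure hd hr
  obtain ⟨⟨hs, hi, ht, hp⟩, hw⟩ := h
  refine ⟨by grind, by grind, torsionBy_two_mul_eq_closure (by decide) h4 ?_ ?_⟩
  · apply two_nsmul_twistPoint (l := -(s * (1 - p) + t)) <;> grind
  · apply two_nsmul_twistPoint (l := -(w - i * (1 - p))) <;> grind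

theorem divisionField_two_eq (hd : d ≠ 0) (hr : r ^ 2 = d) (hs : s ^ 2 = 2) :
    divisionField (curveE d) Ω 2 = ℚ⟮s⟯ := by
  obtain ⟨_, _, h2⟩ := exists_torsionBy_two_eq_closure hd hr hs
  refine eq_of_forall_ge_iff fun K => ?_
  rw [divisionField_le_iff_of_torsionBy_eq_closure h2, twistPoint_mem_rationalPoints_iff,
    twistPoint_mem_rationalPoints_iff, adjoin_simple_le_iff]
  refine ⟨fun ⟨_, hu, _⟩ => ?_, fun hsK => ⟨⟨zero_mem K, ?_⟩, ?_, ?_⟩⟩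
  · rw [show s = -(-2 - s) - 2 by ring]
    exact sub_mem (neg_mem hu) (ofNat_mem _ _)
  · exact (mul_zero r).symm ▸ zero_mem K
  · exact sub_mem (neg_mem (ofNat_mem _ _)) hsK
  · exact (mul_zero r).symm ▸ zero_mem K

theorem IsFourTower.divisionField_four_eq (h : IsFourTower s i t p) (hd : d ≠ 0)
    (hr : r ^ 2 = d) : divisionField (curveE d) Ω 4 = ℚ⟮r * t, p, i, s⟯ := by
  obtain ⟨hP, hQ, h4⟩ := h.exists_torsionBy_four_eq_closure hd hr
  obtain ⟨hs, _, ht, hp⟩ := h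
  refine eq_of_forall_ge_iff fun K => ?_
  rw [divisionField_le_iff_of_torsionBy_eq_closure h4, twistPoint_mem_rationalPoints_iff,
    twistPoint_mem_rationalPoints_iff, adjoin_le_iff]
  simp only [Set.insert_subset_iff, Set.singleton_subset_iff, SetLike.mem_coe]
  constructor
  · rintro ⟨⟨hsK, hvP⟩, hu, hvQ⟩
    have hpK : p ∈ K := by
      rw [show p = (2 * p - 2 - s + 2 + s) / 2 by ring]
      exact div_mem (add_mem (add_mem hu (ofNat_mem _ _)) hsK) (ofNat_mem _ _)
    have hrt : r * t ∈ K := by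
      rw [show r * t = r * (2 * t * p) / (2 * p) by field_simp [show p ≠ 0 by grind]]
      exact div_mem hvP (mul_mem (ofNat_mem _ _) hpK)
    refine ⟨hrt, hpK, ?_, hsK⟩
    have hne : (2 * p - 2 - s) * s * (r * t) ≠ 0 := mul_ne_zero
      (mul_ne_zero (by grind) (by grind)) (mul_ne_zero (sqrt_ne_zero hd hr) (by grind))
    rw [show i = r * ((2 * p - 2 - s) * (i * s * t)) / ((2 * p - 2 - s) * s * (r * t)) by
      rw [eq_div_iff hne]; ring]
    exact div_mem hvQ (mul_mem (mul_mem hu hsK) hrt)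
  · rintro ⟨hrt, hpK, hiK, hsK⟩
    rw [show r * (2 * t * p) = r * t * (2 * p) by ring,
      show r * ((2 * p - 2 - s) * (i * s * t)) = (2 * p - 2 - s) * i * s * (r * t) by ring]
    aesop

theorem IsEightTower.divisionField_eight_eq (h : IsEightTower s i t p w) (hd : d ≠ 0)
    (hr : r ^ 2 = d) : divisionField (curveE d) Ω 8 = ℚ⟮r, w, p, t, i, s⟯ := by
  obtain ⟨c, hc⟩ : ∃ c, c = w ^ 2 / 2 - 2 - i * (1 - p) * w := ⟨_, rfl⟩
  obtain ⟨hP, hQ, h8⟩ := h.exists_torsionBy_eight_eq_closure hd hr hc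
  have h4 := h.toIsFourTower.divisionField_four_eq hd hr
  obtain ⟨⟨hs, hi, ht, hp⟩, hw⟩ := h
  refine eq_of_forall_ge_iff fun K => ?_
  have h48 : divisionField (curveE d) Ω 8 ≤ K → ℚ⟮r * t, p, i, s⟯ ≤ K :=
    h4 ▸ (divisionField_mono (by decide)).trans
  simp only [adjoin_le_iff, Set.insert_subset_iff, Set.singleton_subset_iff,
    SetLike.mem_coe] at h48 ⊢
  constructor
  · intro hK
    obtain ⟨hrt, hpK, hiK, hsK⟩ := h48 hK
    rw [divisionField_le_iff_of_torsionBy_eq_closure h8, twistPoint_mem_rationalPoints_iff,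
      twistPoint_mem_rationalPoints_iff] at hK
    obtain ⟨⟨huP, -⟩, huQ, hvQ⟩ := hK
    have htK : t ∈ K := by
      rw [show t = (-w ^ 2 / 2 + 2 * p - s) / (s * (1 - p)) by
        rw [eq_div_iff (mul_ne_zero (by grind) (by grind)), hw]; ring]
      aesop
    have hrK : r ∈ K := by
      rw [show r = r * t / t by field_simp [show t ≠ 0 by grind]]
      exact div_mem hrt htK
    have hne : r * c ≠ 0 := mul_ne_zero (sqrt_ne_zero hd hr) (by grind)
    refine ⟨hrK, ?_, hpK, htK, hiK, hsK⟩
    rw [show w = -(r * -(c * w)) / (r * c) by rw [eq_div_iff hne]; ring]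
    exact div_mem (neg_mem hvQ) (mul_mem hrK huQ)
  · rintro ⟨hrK, hwK, hpK, htK, hiK, hsK⟩
    rw [divisionField_le_iff_of_torsionBy_eq_closure h8, twistPoint_mem_rationalPoints_iff,
      twistPoint_mem_rationalPoints_iff]
    aesop

end TorsionGenerators

section QuarticRoot

variable {Ω : Type*} [Field Ω] [Algebra ℚ Ω] {α s t : Ω}

theorem exists_adjoin_simple_eq_of_pow_four (ht : t ^ 2 = s) (hs : s ^ 2 = 2)
    (hα : α ^ 4 = -(1 + s) ^ 2) : ∃ i p, IsFourTower s i t p ∧ ℚ⟮α⟯ = ℚ⟮p, i, s⟯ := by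
  have h1s : 1 + s ≠ 0 := by grind
  have hi : (α ^ 2 / (1 + s)) ^ 2 = -1 := by
    rw [div_pow, ← pow_mul, hα]
    field_simp
  obtain ⟨i, hi_eq⟩ : ∃ i, i = α ^ 2 / (1 + s) := ⟨_, rfl⟩
  rw [← hi_eq] at hi
  have h1i : 1 + i ≠ 0 := by grind
  have hs0 : s ≠ 0 := by grind
  obtain ⟨p, hp_eq⟩ : ∃ p, p = α * s / (1 + i) := ⟨_, rfl⟩
  have hp : p ^ 2 = 1 + s := by
    have hα2 : α ^ 2 = i * (1 + s) := by rw [hi_eq]; field_simp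
    rw [hp_eq, div_pow, mul_pow, hα2, div_eq_iff (pow_ne_zero 2 h1i)]
    linear_combination i * (1 + s) * hs - (1 + s) * hi
  refine ⟨i, p, ⟨hs, hi, ht, hp⟩, eq_of_forall_ge_iff fun K => ?_⟩
  simp only [adjoin_le_iff, Set.insert_subset_iff, Set.singleton_subset_iff, SetLike.mem_coe]
  constructor
  · intro hαK
    have hsK : s ∈ K := by
      rw [show s = -(α ^ 4 + 3) / 2 by linear_combination (hα - hs) / 2]
      exact div_mem (neg_mem (add_mem (pow_mem hαK 4) (ofNat_mem _ 3))) (ofNat_mem _ 2)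
    have hiK : i ∈ K := hi_eq ▸ div_mem (pow_mem hαK 2) (add_mem (one_mem _) hsK)
    exact ⟨hp_eq ▸ div_mem (mul_mem hαK hsK) (add_mem (one_mem _) hiK), hiK, hsK⟩
  · rintro ⟨hpK, hiK, hsK⟩
    rw [show α = p * (1 + i) / s by rw [hp_eq]; field_simp]
    exact div_mem (mul_mem hpK (add_mem (one_mem _) hiK)) hsK

theorem exists_isFourTower_of_aeval_f4_eq_zero (ht : t ^ 4 = 2) (hα : aeval α f4 = 0) :
    ∃ s i p, IsFourTower s i t p ∧ ℚ⟮α⟯ = ℚ⟮p, i, s⟯ := by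
  have hα8 : α ^ 8 + 6 * α ^ 4 + 1 = 0 := by
    simpa only [f4, map_add, map_mul, map_pow, aeval_X, map_ofNat, map_one] using hα
  have hs : (t ^ 2) ^ 2 = 2 := by rw [← pow_mul, ht]
  refine ⟨t ^ 2, ?_⟩
  have hsplit : (α ^ 4 + (1 + t ^ 2) ^ 2) * (α ^ 4 + (1 - t ^ 2) ^ 2) = 0 := by grind
  rcases mul_eq_zero.mp hsplit with h | h
  · exact exists_adjoin_simple_eq_of_pow_four rfl hs (eq_neg_of_add_eq_zero_left h)
  · have hinv : α⁻¹ ^ 4 = -(1 + t ^ 2) ^ 2 := by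
      rw [inv_pow]
      exact inv_eq_of_mul_eq_one_left (by grind)
    have hadjoin : ℚ⟮α⁻¹⟯ = ℚ⟮α⟯ := eq_of_forall_ge_iff fun K => by simp
    exact hadjoin ▸ exists_adjoin_simple_eq_of_pow_four rfl hs hinv

end QuarticRoot

section RootDescent

variable {R : Type*} [CommRing R]

/-- The element `x` such that the roots `β` of `f8` satisfy `(2 * β + 1 - x) ^ 2 ∈ ℚ(s, i, t, p)`
for a suitable tower. -/
def rootShift {F : Type*} [Field F] (s i t p : F) : F := (i - 1) * s * t / 2 - i * p

/-- The value of `(2 * β + 1 - rootShift s i t p) ^ 2` at a root `β` of `f8`. -/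
def rootRadicand (s i t p : R) : R := 2 * p - 2 * t + 2 * t * p - s + i * s

/-- The coefficient of `p ^ 0` in `(y - rootShift s i t p) ^ 2 - rootRadicand s i t p`. -/
def descentX (y s i t : R) : R := y ^ 2 - 1 - 2 * i * s + t * (2 + (1 - i) * s * y)

/-- The coefficient of `p` in `(y - rootShift s i t p) ^ 2 - rootRadicand s i t p`. -/
def descentY (y s i t : R) : R := 2 * i * y - 2 + t * ((1 + i) * s - 2)

/-- The coefficient of `t ^ 0` in the norm of `descentX y s i t + p * descentY y s i t`. -/
def descentU (y s i : R) : R :=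
  y ^ 4 + (2 + 4 * s - 8 * i * s) * y ^ 2 + (8 + 8 * i * s) * y + (4 * s - 11 + 8 * i * s)

/-- The coefficient of `t` in the norm of `descentX y s i t + p * descentY y s i t`. -/
def descentV (y s i : R) : R :=
  (2 * s - 2 * i * s) * y ^ 3 + 4 * y ^ 2 + (2 * s - 8 * i + 6 * i * s) * y
    + (8 * i - 4 * s - 4 - 4 * i * s)

/-- The coefficient of `1` in the norm of `descentU y s i + t * descentV y s i`, with respect to
the basis `1, i, s, i * s`. -/
def descentA (y : R) : R :=
  y ^ 8 + 4 * y ^ 6 - 16 * y ^ 5 - 50 * y ^ 4 + 224 * y ^ 3 + 84 * y ^ 2 - 80 * y - 167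

/-- The coefficient of `i` in the norm of `descentU y s i + t * descentV y s i`, with respect to
the basis `1, i, s, i * s`. -/
def descentB (y : R) : R :=
  32 * y ^ 5 - 64 * y ^ 4 - 64 * y ^ 3 + 128 * y ^ 2 + 32 * y + 192

/-- The coefficient of `s` in the norm of `descentU y s i + t * descentV y s i`, with respect to
the basis `1, i, s, i * s`. -/
def descentC (y : R) : R :=
  8 * y ^ 6 - 56 * y ^ 4 + 128 * y ^ 3 + 88 * y ^ 2 - 128 * y - 40

/-- The coefficient of `i * s` in the norm of `descentU y s i + t * descentV y s i`, with respect to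
the basis `1, i, s, i * s`. -/
def descentD (y : R) : R :=
  16 * y ^ 5 - 48 * y ^ 4 - 32 * y ^ 3 + 224 * y ^ 2 + 16 * y - 176

/-- The real part of the norm of
`descentA y + i * descentB y + s * (descentC y + i * descentD y)` to `ℚ(i, y)`. -/
def descentRe (y : R) : R :=
  descentA y ^ 2 - descentB y ^ 2 - 2 * descentC y ^ 2 + 2 * descentD y ^ 2

/-- The imaginary part of the norm of
`descentA y + i * descentB y + s * (descentC y + i * descentD y)` to `ℚ(i, y)`. -/
def descentIm (y : R) : R := 2 * descentA y * descentB y - 4 * descentC y * descentD y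

theorem descentRe_sq_add_descentIm_sq {A : Type*} [CommRing A] [Algebra ℚ A] (β : A) :
    descentRe (2 * β + 1) ^ 2 + descentIm (2 * β + 1) ^ 2 = 2 ^ 32 * aeval β f8 := by
  simp only [f8, map_add, map_sub, map_mul, map_pow, aeval_X, map_ofNat, map_one, descentRe,
    descentIm, descentA, descentB, descentC, descentD]
  ring

theorem norm_descent_s {y i : R} (hi : i ^ 2 = -1) :
    (descentA y + i * descentB y) ^ 2 - 2 * (descentC y + i * descentD y) ^ 2 =
      descentRe y + i * descentIm y := by
  rw [descentRe, descentIm]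
  linear_combination (descentB y ^ 2 - 2 * descentD y ^ 2) * hi

theorem norm_descent_t {y s i : R} (hs : s ^ 2 = 2) (hi : i ^ 2 = -1) :
    descentU y s i ^ 2 - s * descentV y s i ^ 2 =
      descentA y + i * descentB y + s * (descentC y + i * descentD y) := by
  simp only [descentU, descentV, descentA, descentB, descentC, descentD]
  grind

theorem norm_descent_p {y s i t : R} (hs : s ^ 2 = 2) (hi : i ^ 2 = -1) (ht : t ^ 2 = s) :
    descentX y s i t ^ 2 - (1 + s) * descentY y s i t ^ 2 =
      descentU y s i + t * descentV y s i := by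
  simp only [descentX, descentY, descentU, descentV]
  grind

end RootDescent

theorem exists_sq_eq_add_mul_eq_zero {Ω : Type*} [Field Ω] [IsAlgClosed Ω] {a b c : Ω}
    (h : a ^ 2 - c * b ^ 2 = 0) : ∃ e, e ^ 2 = c ∧ a + e * b = 0 := by
  obtain ⟨e, rfl⟩ := IsAlgClosed.exists_pow_nat_eq c two_pos
  rcases mul_eq_zero.mp (show (a + e * b) * (a - e * b) = 0 by linear_combination h) with h | h
  · exact ⟨e, rfl, h⟩
  · exact ⟨-e, neg_sq e, by linear_combination h⟩

/-- The element `β` is one of the two solutions of the quadratic equation over `ℚ(s, i, t, p)`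
that defines a root of `f8`. -/
structure IsRootTower {Ω : Type*} [Field Ω] (β s i t p : Ω) : Prop extends
    IsFourTower s i t p where
  sq_eq : (2 * β + 1 - rootShift s i t p) ^ 2 = rootRadicand s i t p

/-- The factor relating the two descriptions `√(4p - 2s - 2st(1 - p))` and
`√(rootRadicand s i t p)` of the last generator of the field of definition of the `8`-torsion. -/
def topFactor {F : Type*} [Field F] (s i t p : F) : F :=
  (-2 + 2 * p + 2 * t + 2 * t * p + s - 3 * s * p - s * t - 2 * s * t * p - 4 * i * p - 2 * i * t
    + i * s + 3 * i * s * p + i * s * t) / 4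

theorem exists_isRootTower {Ω : Type*} [Field Ω] [Algebra ℚ Ω] [IsAlgClosed Ω] {β : Ω}
    (hβ : aeval β f8 = 0) : ∃ s i t p, IsRootTower β s i t p := by
  obtain ⟨i, hi, h₁⟩ : ∃ i : Ω, i ^ 2 = -1 ∧
      descentRe (2 * β + 1) + i * descentIm (2 * β + 1) = 0 :=
    exists_sq_eq_add_mul_eq_zero (by
      rw [neg_one_mul, sub_neg_eq_add, descentRe_sq_add_descentIm_sq, hβ, mul_zero])
  obtain ⟨s, hs, h₂⟩ := exists_sq_eq_add_mul_eq_zero ((norm_descent_s hi).trans h₁)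
  obtain ⟨t, ht, h₃⟩ := exists_sq_eq_add_mul_eq_zero ((norm_descent_t hs hi).trans h₂)
  obtain ⟨p, hp, h₄⟩ := exists_sq_eq_add_mul_eq_zero ((norm_descent_p hs hi ht).trans h₃)
  refine ⟨s, i, t, p, ⟨hs, hi, ht, hp⟩, ?_⟩
  rw [← sub_eq_zero, ← h₄, rootShift, rootRadicand, descentX, descentY]
  clear h₁ h₂ h₃ h₄ hβ
  grind

namespace IsFourTower

variable {Ω : Type*} [Field Ω] [Algebra ℚ Ω] {s i t p s' i' t' p' : Ω}

theorem mem_adjoin_of_isFourTower (h : IsFourTower s i t p) (h' : IsFourTower s' i' t' p') :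
    s' ∈ ℚ⟮t, i, s⟯ ∧ i' ∈ ℚ⟮t, i, s⟯ ∧ t' ∈ ℚ⟮t, i, s⟯ ∧ ∃ ν ∈ ℚ⟮t, i, s⟯, p' = ν * p := by
  have hs : s ∈ ℚ⟮t, i, s⟯ := subset_adjoin ℚ _ (by simp)
  have hi : i ∈ ℚ⟮t, i, s⟯ := subset_adjoin ℚ _ (by simp)
  have ht : t ∈ ℚ⟮t, i, s⟯ := subset_adjoin ℚ _ (by simp)
  have mem_of_sq_eq {x z c : Ω} (hx : x ∈ ℚ⟮t, i, s⟯) (h : z ^ 2 = (x * c) ^ 2) :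
      ∃ ν ∈ ℚ⟮t, i, s⟯, z = ν * c := by
    rcases sq_eq_sq_iff_eq_or_eq_neg.mp h with h | h
    exacts [⟨x, hx, h⟩, ⟨-x, neg_mem hx, by rw [h, neg_mul]⟩]
  obtain ⟨hs_sq, hi_sq, ht_sq, hp_sq⟩ := h
  obtain ⟨hs_sq', hi_sq', ht_sq', hp_sq'⟩ := h'
  have hi' : i' = i ∨ i' = -i := sq_eq_sq_iff_eq_or_eq_neg.mp (hi_sq'.trans hi_sq.symm)
  have hi'K : i' ∈ ℚ⟮t, i, s⟯ := by rcases hi' with rfl | rfl; exacts [hi, neg_mem hi]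
  rcases sq_eq_sq_iff_eq_or_eq_neg.mp (hs_sq'.trans hs_sq.symm) with rfl | rfl
  · obtain ⟨ν, hν, rfl⟩ := mem_of_sq_eq (z := t') (c := 1) ht (by rw [mul_one, ht_sq, ht_sq'])
    exact ⟨hs, hi'K, mul_mem hν (one_mem _), mem_of_sq_eq (one_mem _) (by simp [hp_sq, hp_sq'])⟩
  · obtain ⟨ν, hν, rfl⟩ := mem_of_sq_eq (z := t') (c := 1) (mul_mem hi ht) (by grind)
    exact ⟨neg_mem hs, hi'K, mul_mem hν (one_mem _),
      mem_of_sq_eq (mul_mem hi (sub_mem hs (one_mem _))) (by grind)⟩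

theorem eq_of_mul_eq (h : IsFourTower s i t p) (h' : IsFourTower s' i' t' p')
    (hst : (i - 1) * s * t = (i' - 1) * s' * t') (hip : i * p = i' * p') :
    s = s' ∧ i = i' ∧ t = t' ∧ p = p' := by
  obtain ⟨hs, hi, ht, hp⟩ := h
  obtain ⟨hs', hi', ht', hp'⟩ := h'
  obtain rfl : s = s' := by grind
  have sq_eq {j u : Ω} (hj : j ^ 2 = -1) (hu : u ^ 2 = s) :
      ((j - 1) * s * u) ^ 2 = -4 * s * j := by grind
  obtain rfl : i = i' := mul_left_cancel₀ (show -4 * s ≠ 0 by grind) <| by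
    rw [← sq_eq hi ht, hst, sq_eq hi' ht']
  have hs0 : (i - 1) * s ≠ 0 := by grind
  exact ⟨rfl, rfl, mul_left_cancel₀ hs0 hst, by grind⟩

end IsFourTower

theorem IsFourTower.map_iff {F Ω : Type*} [Field F] [Field Ω] (φ : F →+* Ω) {s i t p : F} :
    IsFourTower (φ s) (φ i) (φ t) (φ p) ↔ IsFourTower s i t p := by
  have hs : φ s ^ 2 = 2 ↔ s ^ 2 = 2 := by rw [← map_pow, ← map_ofNat φ, φ.injective.eq_iff]
  have hi : φ i ^ 2 = -1 ↔ i ^ 2 = -1 := by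
    rw [← map_pow, ← map_one φ, ← map_neg, φ.injective.eq_iff]
  have ht : φ t ^ 2 = φ s ↔ t ^ 2 = s := by rw [← map_pow, φ.injective.eq_iff]
  have hp : φ p ^ 2 = 1 + φ s ↔ p ^ 2 = 1 + s := by
    rw [← map_pow, ← map_one φ, ← map_add, φ.injective.eq_iff]
  exact ⟨fun h => ⟨hs.mp h.s_sq, hi.mp h.i_sq, ht.mp h.t_sq, hp.mp h.p_sq⟩,
    fun h => ⟨hs.mpr h.s_sq, hi.mpr h.i_sq, ht.mpr h.t_sq, hp.mpr h.p_sq⟩⟩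

namespace IsRootTower

theorem map_iff {F Ω : Type*} [Field F] [Field Ω] (φ : F →+* Ω) {β s i t p : F} :
    IsRootTower (φ β) (φ s) (φ i) (φ t) (φ p) ↔ IsRootTower β s i t p := by
  have hshift : rootShift (φ s) (φ i) (φ t) (φ p) = φ (rootShift s i t p) := by
    simp only [rootShift, map_sub, map_div₀, map_mul, map_one, map_ofNat]
  have hrad : rootRadicand (φ s) (φ i) (φ t) (φ p) = φ (rootRadicand s i t p) := by
    simp only [rootRadicand, map_add, map_sub, map_mul, map_ofNat]
  have hsq : (2 * φ β + 1 - rootShift (φ s) (φ i) (φ t) (φ p)) ^ 2 =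
      φ ((2 * β + 1 - rootShift s i t p) ^ 2) := by
    simp only [hshift, map_pow, map_sub, map_add, map_mul, map_ofNat, map_one]
  constructor
  · rintro ⟨h4, h⟩
    exact ⟨(IsFourTower.map_iff φ).mp h4, φ.injective (hsq.symm.trans (h.trans hrad))⟩
  · rintro ⟨h4, h⟩
    exact ⟨(IsFourTower.map_iff φ).mpr h4, hsq.trans ((congrArg φ h).trans hrad.symm)⟩

theorem isEightTower {Ω : Type*} [Field Ω] [Algebra ℚ Ω] {β s i t p : Ω}
    (h : IsRootTower β s i t p) :
    IsEightTower s i t p (topFactor s i t p * (2 * β + 1 - rootShift s i t p)) := by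
  refine ⟨h.toIsFourTower, ?_⟩
  obtain ⟨⟨hs, hi, ht, hp⟩, h⟩ := h
  rw [mul_pow, h, topFactor, rootRadicand]
  clear h
  grind

end IsRootTower

section Membership

variable {Ω : Type*} [Field Ω] [Algebra ℚ Ω] {K : IntermediateField ℚ Ω} {s i t p : Ω}

theorem rootShift_mem (hs : s ∈ K) (hi : i ∈ K) (ht : t ∈ K) (hp : p ∈ K) :
    rootShift s i t p ∈ K := by
  rw [rootShift]
  aesop

theorem rootRadicand_mem (hs : s ∈ K) (hi : i ∈ K) (ht : t ∈ K) (hp : p ∈ K) :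
    rootRadicand s i t p ∈ K := by
  rw [rootRadicand]
  aesop

theorem topFactor_mem (hs : s ∈ K) (hi : i ∈ K) (ht : t ∈ K) (hp : p ∈ K) :
    topFactor s i t p ∈ K := by
  rw [topFactor]
  aesop

end Membership

namespace IsRootTower

variable {Ω : Type*} [Field Ω] [Algebra ℚ Ω] {β s i t p s' i' t' p' : Ω}

theorem sub_rootShift_notMem (h : IsRootTower β s i t p) :
    2 * β + 1 - rootShift s i t p ∉ ℚ⟮p, t, i, s⟯ := fun hmem =>
  h.isEightTower.w_notMem <| mul_mem (topFactor_mem (subset_adjoin ℚ _ (by simp))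
    (subset_adjoin ℚ _ (by simp)) (subset_adjoin ℚ _ (by simp)) (subset_adjoin ℚ _ (by simp))) hmem

theorem rootShift_eq (h : IsRootTower β s i t p) (h' : IsRootTower β s' i' t' p')
    {K : IntermediateField ℚ Ω} (hK : 2 * β + 1 - rootShift s i t p ∉ K)
    (hmem : s ∈ K ∧ i ∈ K ∧ t ∈ K ∧ p ∈ K) (hmem' : s' ∈ K ∧ i' ∈ K ∧ t' ∈ K ∧ p' ∈ K) :
    rootShift s i t p = rootShift s' i' t' p' := by
  obtain ⟨hs, hi, ht, hp⟩ := hmem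
  obtain ⟨hs', hi', ht', hp'⟩ := hmem'
  have hshift := rootShift_mem hs hi ht hp
  have hshift' := rootShift_mem hs' hi' ht' hp'
  by_contra hne
  have hsub : 2 * (rootShift s i t p - rootShift s' i' t' p') ≠ 0 :=
    mul_ne_zero two_ne_zero (sub_ne_zero.mpr hne)
  apply hK
  rw [show 2 * β + 1 - rootShift s i t p = (rootRadicand s' i' t' p' - rootRadicand s i t p -
      (rootShift s i t p - rootShift s' i' t' p') ^ 2) /
      (2 * (rootShift s i t p - rootShift s' i' t' p')) by
    rw [eq_div_iff hsub, ← h.sq_eq, ← h'.sq_eq]; ring]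
  have hδ := sub_mem hshift hshift'
  exact div_mem (sub_mem (sub_mem (rootRadicand_mem hs' hi' ht' hp')
    (rootRadicand_mem hs hi ht hp)) (pow_mem hδ 2)) (mul_mem (ofNat_mem _ 2) hδ)

theorem unique (h : IsRootTower β s i t p) (h' : IsRootTower β s' i' t' p') :
    s = s' ∧ i = i' ∧ t = t' ∧ p = p' := by
  obtain ⟨hs', hi', ht', ν, hν, hp'⟩ := h.mem_adjoin_of_isFourTower h'.toIsFourTower
  have hle : ℚ⟮t, i, s⟯ ≤ ℚ⟮p, t, i, s⟯ := adjoin.mono _ _ _ (Set.subset_insert p _)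
  have hp : p ∈ ℚ⟮p, t, i, s⟯ := subset_adjoin ℚ _ (by simp)
  have hs : s ∈ ℚ⟮t, i, s⟯ := subset_adjoin ℚ _ (by simp)
  have hi : i ∈ ℚ⟮t, i, s⟯ := subset_adjoin ℚ _ (by simp)
  have ht : t ∈ ℚ⟮t, i, s⟯ := subset_adjoin ℚ _ (by simp)
  have hshift := h.rootShift_eq h' h.sub_rootShift_notMem ⟨hle hs, hle hi, hle ht, hp⟩
    ⟨hle hs', hle hi', hle ht', hp' ▸ mul_mem (hle hν) hp⟩
  rw [rootShift, rootShift, hp'] at hshift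
  obtain ⟨hst, hip⟩ := eq_zero_of_add_mul_eq_zero h.p_notMem
    (x := (i - 1) * s * t - (i' - 1) * s' * t') (y := 2 * (i' * ν - i))
    (sub_mem (mul_mem (mul_mem (sub_mem hi (one_mem _)) hs) ht)
      (mul_mem (mul_mem (sub_mem hi' (one_mem _)) hs') ht'))
    (mul_mem (ofNat_mem _ 2) (sub_mem (mul_mem hi' hν) hi)) (by linear_combination 2 * hshift)
  refine h.eq_of_mul_eq h'.toIsFourTower (sub_eq_zero.mp hst) ?_
  rw [hp']
  linear_combination -(p / 2) * hip

theorem topFactor_ne_zero (h : IsRootTower β s i t p) : topFactor s i t p ≠ 0 := fun h0 => by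
  have hw := h.isEightTower.w_notMem
  rw [h0, zero_mul] at hw
  exact hw (zero_mem _)

theorem adjoin_insert_eq (h : IsRootTower β s i t p) :
    ℚ⟮β, p, t, i, s⟯ = ℚ⟮topFactor s i t p * (2 * β + 1 - rootShift s i t p), p, t, i, s⟯ := by
  have h0 := h.topFactor_ne_zero
  refine eq_of_forall_ge_iff fun K => ?_
  simp only [adjoin_le_iff, Set.insert_subset_iff, Set.singleton_subset_iff, SetLike.mem_coe]
  refine and_congr_left fun ⟨hp, ht, hi, hs⟩ => ?_
  have hfactor := topFactor_mem hs hi ht hp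
  have hshift := rootShift_mem hs hi ht hp
  refine ⟨fun hβ => mul_mem hfactor (sub_mem (add_mem (mul_mem (ofNat_mem _ 2) hβ) (one_mem _))
    hshift), fun hw => ?_⟩
  rw [show β = (topFactor s i t p * (2 * β + 1 - rootShift s i t p) / topFactor s i t p +
    rootShift s i t p - 1) / 2 by rw [mul_div_cancel_left₀ _ h0]; ring]
  exact div_mem (sub_mem (add_mem (div_mem hw hfactor) hshift) (one_mem _)) (ofNat_mem _ 2)

theorem adjoin_simple_eq [IsAlgClosed Ω] (h : IsRootTower β s i t p) :
    ℚ⟮β⟯ = ℚ⟮topFactor s i t p * (2 * β + 1 - rootShift s i t p), p, t, i, s⟯ := by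
  have hfin := h.isEightTower.finiteDimensional_adjoin
  rw [← h.adjoin_insert_eq] at hfin ⊢
  refine adjoin_simple_eq_of_forall_algHom (subset_adjoin ℚ _ (by simp)) fun ψ hψ => ?_
  have hL : IsRootTower (⟨β, subset_adjoin ℚ _ (by simp)⟩ : ℚ⟮β, p, t, i, s⟯)
      ⟨s, subset_adjoin ℚ _ (by simp)⟩ ⟨i, subset_adjoin ℚ _ (by simp)⟩
      ⟨t, subset_adjoin ℚ _ (by simp)⟩ ⟨p, subset_adjoin ℚ _ (by simp)⟩ :=
    (map_iff (algebraMap _ Ω)).mp h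
  have hψL := (map_iff (RingHomClass.toRingHom ψ)).mpr hL
  rw [RingHom.coe_coe, hψ] at hψL
  obtain ⟨hs, hi, ht, hp⟩ := h.unique hψL
  rintro z (rfl | rfl | rfl | rfl | rfl)
  exacts [hψ, hp.symm, ht.symm, hi.symm, hs.symm]

end IsRootTower

theorem adjoin_pair_eq_adjoin_insert {k L : Type*} [Field k] [Field L] [Algebra k L] {S : Set L}
    {x y : L} (h : k⟮x⟯ = adjoin k S) : k⟮x, y⟯ = adjoin k (insert y S) := by
  rw [Set.pair_comm, Set.insert_eq, adjoin_union, h, ← adjoin_union, ← Set.insert_eq]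

theorem IsEightTower.exists_of_isAlgClosed (Ω : Type*) [Field Ω] [IsAlgClosed Ω] :
    ∃ s i t p w : Ω, IsEightTower s i t p w := by
  obtain ⟨s, hs⟩ := IsAlgClosed.exists_pow_nat_eq (2 : Ω) two_pos
  obtain ⟨i, hi⟩ := IsAlgClosed.exists_pow_nat_eq (-1 : Ω) two_pos
  obtain ⟨t, ht⟩ := IsAlgClosed.exists_pow_nat_eq s two_pos
  obtain ⟨p, hp⟩ := IsAlgClosed.exists_pow_nat_eq (1 + s) two_pos
  obtain ⟨w, hw⟩ := IsAlgClosed.exists_pow_nat_eq (4 * p - 2 * s - 2 * s * t * (1 - p)) two_pos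
  exact ⟨s, i, t, p, w, ⟨hs, hi, ht, hp⟩, hw⟩

theorem IsEightTower.finrank_divisionField_eight {Ω : Type*} [Field Ω] [Algebra ℚ Ω]
    [DecidableEq Ω] {r s i t p w : Ω} (h : IsEightTower s i t p w) {d : ℤ} (hd : Squarefree d)
    (hr : r ^ 2 = d) :
    Module.finrank ℚ (divisionField (curveE d) Ω 8) =
      if d = 1 ∨ d = -1 ∨ d = 2 ∨ d = -2 then 32 else 64 := by
  rw [h.divisionField_eight_eq hd.ne_zero hr]
  split_ifs with hd'
  · rw [adjoin_insert_eq_of_mem ((h.sqrt_mem_iff hd hr).mpr hd'), h.finrank_adjoin]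
  · rw [finrank_adjoin_insert (hr ▸ intCast_mem _ d) (mt (h.sqrt_mem_iff hd hr).mp hd'),
      h.finrank_adjoin]

theorem mainTheorem7 {Ω : Type*} [Field Ω] [Algebra ℚ Ω] [IsAlgClosed Ω] [DecidableEq Ω]
    (d : ℤ) (hd : Squarefree d) :
    (∀ s : Ω, s ^ 2 = 2 →
      divisionField (curveE d) Ω 2 = IntermediateField.adjoin ℚ {s}) ∧
    (∀ α r t : Ω, aeval α f4 = 0 → r ^ 2 = (d : Ω) → t ^ 4 = 2 →
      divisionField (curveE d) Ω 4 = IntermediateField.adjoin ℚ {α, r * t}) ∧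
    (∀ β r : Ω, aeval β f8 = 0 → r ^ 2 = (d : Ω) →
      divisionField (curveE d) Ω 8 = IntermediateField.adjoin ℚ {β, r}) ∧
    Module.finrank ℚ (divisionField (curveE d) Ω 2) = 2 ∧
    Module.finrank ℚ (divisionField (curveE d) Ω 4) = 16 ∧
    (Module.finrank ℚ (divisionField (curveE d) Ω 8) = 32 ↔
      d = 1 ∨ d = -1 ∨ d = 2 ∨ d = -2) ∧
    (¬ (d = 1 ∨ d = -1 ∨ d = 2 ∨ d = -2) →
      Module.finrank ℚ (divisionField (curveE d) Ω 8) = 64) := by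
  have hd0 : d ≠ 0 := hd.ne_zero
  obtain ⟨s, i, t, p, w, h⟩ := IsEightTower.exists_of_isAlgClosed Ω
  obtain ⟨r, hr⟩ := IsAlgClosed.exists_pow_nat_eq (d : Ω) two_pos
  have hrank := h.finrank_divisionField_eight hd hr
  refine ⟨fun s hs => divisionField_two_eq hd0 hr hs, fun α r t hα hr ht => ?_,
    fun β r hβ hr => ?_, ?_, ?_, ?_, fun hd' => hrank.trans (if_neg hd')⟩
  · obtain ⟨s, i, p, h, hadjoin⟩ := exists_isFourTower_of_aeval_f4_eq_zero ht hα
    rw [h.divisionField_four_eq hd0 hr, adjoin_pair_eq_adjoin_insert hadjoin]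
  · obtain ⟨s, i, t, p, h⟩ := exists_isRootTower hβ
    rw [h.isEightTower.divisionField_eight_eq hd0 hr,
      adjoin_pair_eq_adjoin_insert h.adjoin_simple_eq]
  · rw [divisionField_two_eq hd0 hr h.s_sq, finrank_adjoin_sqrt_two h.s_sq]
  · rw [h.divisionField_four_eq hd0 hr, h.finrank_adjoin_mul_t hd0 hr]
  · rw [hrank]
    split_ifs with hd' <;> simp [hd']
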